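/- Let $G$ be a finite group, $K\le G$ a subgroup, $X=G/K$ and $x_0=K\in X$, and let $\lambda$ be the permutation representation of $G$ on $L(X)=\{f:X\to\mathbb C\}$, $[\lambda(g)f](x)=f(g^{-1}x)$. Assume that $(G,K)$ is a Gelfand pair, that is, $\lambda$ is a direct sum of pairwise inequivalent irreducible representations. Let $\tau:G\to G$ be an involutory anti-automorphism, i.e. $\tau(gh)=\tau(h)\tau(g)$ and $\tau(\tau(g))=g$ for all $g,h\in G$, and suppose that $\tau(K)=K$. For a complex representation $(\rho,W)$ of $G$ let $\rho^\tau$ be the representation of $G$ on the dual space $W'$ given by $[\rho^\tau(g)w'](w)=w'(\rho(\tau(g))w)$, write $\sim$ for equivalence of representations, and put $$C_\tau(\rho)=\dim \mathrm{Hom}_G^{\mathrm{Sym}}(\rho^\tau,\rho)-\dim \mathrm{Hom}_G^{\mathrm{Skew}}(\rho^\tau,\rho),$$ where $\mathrm{Hom}_G^{\mathrm{Sym}}(\rho^\tau,\rho)$ (resp. $\mathrm{Hom}_G^{\mathrm{Skew}}(\rho^\tau,\rho)$) is the space of linear maps $A:W'\to W$ with $A\rho^\tau(g)=\rho(g)A$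 for all $g\in G$ and $A^T=A$ (resp. $A^T=-A$), the transpose $A^T:W'\to W''=W$ being determined by $u'(A^Tv')=v'(Au')$ for all $u',v'\in W'$. Since $\tau(K)=K$, $\tau$ induces an involution on the set of $K$-orbits on $X$, sending the $K$-orbit of $gx_0$ to the $K$-orbit of $\tau(g)x_0$; a $K$-orbit is called $\tau$-invariant if it is fixed by this involution. Then: 1. If $\rho$ is an irreducible representation of $G$ occurring in $L(X)$ (that is, equivalent to a subrepresentation of $\lambda$), then $\rho^\tau$ is also irreducible and occurs in $L(X)$. Moreover, if $I$ is a complete set of pairwise inequivalent irreducible representations of $G$ occurring in $L(X)$, then the number of $\rho\in I$ with $\rho^\tau\sim\rho$ equals the number of $\tau$-invariant $K$-orbits on $X$. 2. If $\rho$ is an irreducible representation of $G$ occurring in $L(X)$ and $\rho^\tau\sim\rho$, then $C_\tau(\rho)=1$. -/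

import Mathlib

namespace TwistedFS

universe u v w

/-- An involutory anti-automorphism of a group: `τ (g h) = τ h * τ g` and `τ (τ g) = g`.
(Bijectivity follows from `τ ∘ τ = id`.) -/
structure InvolutoryAntiAut (G : Type u) [Group G] where
  toFun : G → G
  map_mul : ∀ g h : G, toFun (g * h) = toFun h * toFun g
  involutive : ∀ g : G, toFun (toFun g) = g

instance (G : Type u) [Group G] : CoeFun (InvolutoryAntiAut G) (fun _ => G → G) :=
  ⟨InvolutoryAntiAut.toFun⟩

theorem InvolutoryAntiAut.map_one {G : Type u} [Group G] (τ : InvolutoryAntiAut G) :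
    τ 1 = 1 := by
  have h := τ.map_mul 1 1
  rw [mul_one] at h
  exact left_eq_mul.mp h

/-- The `τ`-conjugate representation `ρ^τ` on the dual space:
`(ρ^τ(g) w')(w) = w' (ρ(τ g) w)`. -/
def tauConj {G : Type u} [Group G] (τ : InvolutoryAntiAut G) {W : Type v} [AddCommGroup W]
    [Module ℂ W] (ρ : Representation ℂ G W) : Representation ℂ G (Module.Dual ℂ W) where
  toFun g := (ρ (τ g)).dualMap
  map_one' := by
    rw [τ.map_one, _root_.map_one]
    rfl
  map_mul' g h := by
    rw [τ.map_mul, _root_.map_mul]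
    rfl

theorem tauConj_apply {G : Type u} [Group G] (τ : InvolutoryAntiAut G) {W : Type v}
    [AddCommGroup W] [Module ℂ W] (ρ : Representation ℂ G W) (g : G) (f : Module.Dual ℂ W)
    (w : W) : tauConj τ ρ g f w = f (ρ (τ g) w) := rfl

/-- Equivalence of representations: `ρ ∼ σ`. -/
def Equivalent {G : Type u} [Group G] {V : Type v} [AddCommGroup V] [Module ℂ V]
    {W : Type w} [AddCommGroup W] [Module ℂ W]
    (ρ : Representation ℂ G V) (σ : Representation ℂ G W) : Prop :=
  Nonempty (ρ.Equiv σ)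

/-- `ρ` occurs in `σ`: it is equivalent to a subrepresentation of `σ`. -/
def OccursIn {G : Type u} [Group G] {V : Type v} [AddCommGroup V] [Module ℂ V]
    {W : Type w} [AddCommGroup W] [Module ℂ W]
    (ρ : Representation ℂ G V) (σ : Representation ℂ G W) : Prop :=
  ∃ U : Subrepresentation σ, Equivalent ρ U.toRepresentation

/-- The symmetric intertwiners from `ρ^τ` to `ρ`, i.e. the linear `A : W' → W` with
`A ρ^τ(g) = ρ(g) A` for all `g` and `A^T = A`, where (with `W'' = W`) the transpose is
determined by `u' (A^T v') = v' (A u')`. -/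
def homSym {G : Type u} [Group G] (τ : InvolutoryAntiAut G) {W : Type v} [AddCommGroup W]
    [Module ℂ W] (ρ : Representation ℂ G W) : Submodule ℂ (Module.Dual ℂ W →ₗ[ℂ] W) where
  carrier := {A | (∀ g : G, A ∘ₗ tauConj τ ρ g = ρ g ∘ₗ A) ∧
    ∀ u' v' : Module.Dual ℂ W, v' (A u') = u' (A v')}
  add_mem' := by
    rintro A B ⟨hA, hA'⟩ ⟨hB, hB'⟩
    exact ⟨fun g => by rw [LinearMap.add_comp, LinearMap.comp_add, hA, hB],
      fun u' v' => by simp [hA' u' v', hB' u' v']⟩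
  zero_mem' := ⟨fun g => by simp, fun u' v' => by simp⟩
  smul_mem' := by
    rintro c A ⟨hA, hA'⟩
    exact ⟨fun g => by rw [LinearMap.smul_comp, LinearMap.comp_smul, hA],
      fun u' v' => by simp [hA' u' v']⟩

/-- The antisymmetric intertwiners from `ρ^τ` to `ρ`, i.e. those with `A^T = -A`. -/
def homSkew {G : Type u} [Group G] (τ : InvolutoryAntiAut G) {W : Type v} [AddCommGroup W]
    [Module ℂ W] (ρ : Representation ℂ G W) : Submodule ℂ (Module.Dual ℂ W →ₗ[ℂ] W) where
  carrier := {A | (∀ g : G, A ∘ₗ tauConj τ ρ g = ρ g ∘ₗ A) ∧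
    ∀ u' v' : Module.Dual ℂ W, v' (A u') = -u' (A v')}
  add_mem' := by
    rintro A B ⟨hA, hA'⟩ ⟨hB, hB'⟩
    exact ⟨fun g => by rw [LinearMap.add_comp, LinearMap.comp_add, hA, hB],
      fun u' v' => by simp [hA' u' v', hB' u' v', add_comm]⟩
  zero_mem' := ⟨fun g => by simp, fun u' v' => by simp⟩
  smul_mem' := by
    rintro c A ⟨hA, hA'⟩
    exact ⟨fun g => by rw [LinearMap.smul_comp, LinearMap.comp_smul, hA],
      fun u' v' => by simp [hA' u' v']⟩

/-- The `τ`-Frobenius–Schur number `C_τ(ρ)` (of a finite dimensional representation). -/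
noncomputable def frobeniusSchurNumber {G : Type u} [Group G] (τ : InvolutoryAntiAut G)
    {W : Type v} [AddCommGroup W] [Module ℂ W] (ρ : Representation ℂ G W) : ℤ :=
  (Module.finrank ℂ (homSym τ ρ) : ℤ) - (Module.finrank ℂ (homSkew τ ρ) : ℤ)

/-- The permutation representation on `L(X) = {f : X → ℂ}`, `X = G/K`:
`(λ(g) f)(x) = f (g⁻¹ x)`. -/
def permRep {G : Type u} [Group G] (K : Subgroup G) : Representation ℂ G (G ⧸ K → ℂ) where
  toFun g :=
    { toFun := fun f x => f (g⁻¹ • x)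
      map_add' := fun _ _ => rfl
      map_smul' := fun _ _ => rfl }
  map_one' := by
    ext f x
    simp
  map_mul' g h := by
    refine LinearMap.ext fun f => funext fun x => ?_
    change f ((g * h)⁻¹ • x) = f (h⁻¹ • g⁻¹ • x)
    rw [mul_inv_rev, mul_smul]

/-- A representation decomposes multiplicity-free if it is the direct sum of finitely many
pairwise inequivalent irreducible subrepresentations. -/
def MultiplicityFree {G : Type u} [Group G] {V : Type v} [AddCommGroup V] [Module ℂ V]
    (σ : Representation ℂ G V) : Prop :=
  ∃ (n : ℕ) (U : Fin n → Subrepresentation σ),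
    DirectSum.IsInternal (fun i => (U i).toSubmodule) ∧
    (∀ i, (U i).toRepresentation.IsIrreducible) ∧
    ∀ i j, i ≠ j → ¬ Equivalent (U i).toRepresentation (U j).toRepresentation

/-- `(G, K)` is a Gelfand pair: the permutation representation on `L(G/K)` is
multiplicity-free. -/
def IsGelfandPair {G : Type u} [Group G] (K : Subgroup G) : Prop :=
  MultiplicityFree (permRep K)

/-- The family `(ρ i)` is a complete set of pairwise inequivalent irreducible representations
occurring in `σ`. -/
structure IsCompleteSystem {G : Type u} [Group G] {V : Type v} [AddCommGroup V] [Module ℂ V]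
    (σ : Representation ℂ G V) {I : Type*} {W : I → Type*} [∀ i, AddCommGroup (W i)]
    [∀ i, Module ℂ (W i)] (ρ : ∀ i, Representation ℂ G (W i)) : Prop where
  irreducible : ∀ i, (ρ i).IsIrreducible
  occurs : ∀ i, OccursIn (ρ i) σ
  inequivalent : ∀ i j, i ≠ j → ¬ Equivalent (ρ i) (ρ j)
  complete : ∀ U : Subrepresentation σ, U.toRepresentation.IsIrreducible →
    ∃ i, Equivalent U.toRepresentation (ρ i)

/-- The set `K\X` of `K`-orbits on `X = G/K`. -/
abbrev KOrbits {G : Type u} [Group G] (K : Subgroup G) : Type u :=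
  MulAction.orbitRel.Quotient K (G ⧸ K)

/-- The `K`-orbit `Ω_x` of a point `x` of `X = G/K`. -/
def orbitOf {G : Type u} [Group G] (K : Subgroup G) (x : G ⧸ K) : KOrbits K :=
  Quotient.mk (MulAction.orbitRel K (G ⧸ K)) x

/-- The involution induced by `τ` on the set of `K`-orbits on `X = G/K` when `τ(K) = K`: it
sends the orbit of `g x₀` to the orbit of `τ(g) x₀`, where `x₀ = K`. -/
def tauOrbit {G : Type u} [Group G] (τ : InvolutoryAntiAut G) (K : Subgroup G)
    (hK : τ '' (K : Set G) = K) : KOrbits K → KOrbits K :=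
  Quotient.lift
    (Quotient.lift (fun g : G => orbitOf K (τ g : G ⧸ K)) (by
      intro a b hab
      have hmem : a⁻¹ * b ∈ K := QuotientGroup.leftRel_apply.mp hab
      have hk : τ (a⁻¹ * b) ∈ K := by
        have h : τ (a⁻¹ * b) ∈ τ '' (K : Set G) := ⟨_, hmem, rfl⟩
        rw [hK] at h
        exact h
      refine Quotient.sound (MulAction.orbitRel_apply.mpr ⟨(⟨_, hk⟩ : K)⁻¹, ?_⟩)
      change (((τ (a⁻¹ * b))⁻¹ * τ b : G) : G ⧸ K) = (τ a : G ⧸ K)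
      have hb : τ b = τ (a⁻¹ * b) * τ a := by
        rw [← τ.map_mul, mul_inv_cancel_left]
      rw [hb, inv_mul_cancel_left]))
    (by
      intro x y hxy
      obtain ⟨k, hkx⟩ := MulAction.orbitRel_apply.mp hxy
      induction y using QuotientGroup.induction_on with
      | H g =>
        subst hkx
        have hk : τ (k : G) ∈ K := by
          have h : τ (k : G) ∈ τ '' (K : Set G) := ⟨_, k.2, rfl⟩
          rw [hK] at h
          exact h
        change orbitOf K (τ ((k : G) * g) : G ⧸ K) = orbitOf K (τ g : G ⧸ K)
        rw [τ.map_mul, QuotientGroup.mk_mul_of_mem _ hk])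

theorem tauOrbit_orbitOf {G : Type u} [Group G] (τ : InvolutoryAntiAut G) (K : Subgroup G)
    (hK : τ '' (K : Set G) = K) (g : G) :
    tauOrbit τ K hK (orbitOf K (g : G ⧸ K)) = orbitOf K (τ g : G ⧸ K) := rfl

end TwistedFS

/-! An irreducible `ρ` occurs in L(G/K) exactly when it carries a nonzero K-invariant functional φ.
Multiplicity-freeness makes φ unique up to a scalar, and averaging over K then makes the K-fixed
vector v unique as well. Normalized by φ(v) = 1, the coefficient φ(ρ(g⁻¹)v) is a function on the
K-orbits that depends only on the class of `ρ`: its spherical function s. Passing to `ρ^τ` swaps the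
roles of φ and v (`IsSpherical.tauConj`), so `ρ^τ` has spherical function s ∘ `tauOrbit` and occurs
too. The spherical functions form a basis of the functions on K\X (`exists_basis_isSpherical`),
which composition with `tauOrbit` permutes as ρ ↦ ρ^τ permutes the classes. The trace of this
operator, computed in that basis and in the basis of delta functions, gives the count. If A : ρ^τ →
ρ is an equivalence, so is its transpose, hence A^T = cA by Schur. Aφ is a nonzero K-fixed vector,
so φ(Aφ) ≠ 0; pairing with φ forces c = 1. Thus every intertwiner is symmetric. -/

namespace TwistedFS

open Representation

/-! ### Equivalence, irreducibility and Schur's lemma. -/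

section Equivalence

variable {G : Type*} [Group G] {V W Z : Type*} [AddCommGroup V] [Module ℂ V] [AddCommGroup W]
  [Module ℂ W] [AddCommGroup Z] [Module ℂ Z]
  {ρ : Representation ℂ G V} {σ : Representation ℂ G W} {π : Representation ℂ G Z}

theorem Equivalent.symm (h : Equivalent ρ σ) : Equivalent σ ρ :=
  h.map Representation.Equiv.symm

theorem Equivalent.trans (h : Equivalent ρ σ) (h' : Equivalent σ π) : Equivalent ρ π :=
  h.elim fun e => h'.map e.trans

theorem isIrreducible_iff :
    ρ.IsIrreducible ↔ Nontrivial V ∧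
      ∀ U : Submodule ℂ V, (∀ g, ∀ v ∈ U, ρ g v ∈ U) → U = ⊥ ∨ U = ⊤ := by
  constructor
  · intro h
    refine ⟨?_, fun U hU => ?_⟩
    · by_contra hV
      rw [not_nontrivial_iff_subsingleton] at hV
      exact bot_ne_top (α := Subrepresentation ρ)
        (Subrepresentation.toSubmodule_injective (Subsingleton.elim _ _))
    · exact (eq_bot_or_eq_top (⟨U, fun g v hv => hU g v hv⟩ : Subrepresentation ρ)).imp
        (congrArg Subrepresentation.toSubmodule) (congrArg Subrepresentation.toSubmodule)
  · rintro ⟨hV, h⟩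
    have : Nontrivial (Subrepresentation ρ) :=
      ⟨⊥, ⊤, fun h => bot_ne_top (α := Submodule ℂ V)
        (congrArg Subrepresentation.toSubmodule h)⟩
    exact ⟨fun U => (h U.toSubmodule fun g v hv => U.apply_mem_toSubmodule g hv).imp
      (fun h => Subrepresentation.toSubmodule_injective h)
      (fun h => Subrepresentation.toSubmodule_injective h)⟩

theorem Equivalent.isIrreducible (h : Equivalent ρ σ) (hρ : ρ.IsIrreducible) :
    σ.IsIrreducible := by
  obtain ⟨e⟩ := h
  obtain ⟨hV, hU⟩ := isIrreducible_iff.1 hρ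
  refine isIrreducible_iff.2 ⟨e.toLinearEquiv.symm.toEquiv.nontrivial, fun U hUσ => ?_⟩
  have key := hU (U.comap e.toLinearEquiv.toLinearMap) fun g v hv => by
    have := hUσ g _ hv
    rw [Submodule.mem_comap]
    convert! this using 1
    exact IntertwiningMap.isIntertwining _ _ e.toIntertwiningMap g v
  refine key.imp (fun h => ?_) (fun h => ?_)
  · exact Submodule.comap_injective_of_surjective e.toLinearEquiv.surjective
      (h.trans (LinearEquiv.ker e.toLinearEquiv).symm)
  · exact Submodule.comap_injective_of_surjective e.toLinearEquiv.surjective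
      (by rw [h]; rfl)

theorem OccursIn.finiteDimensional [FiniteDimensional ℂ W] (h : OccursIn ρ σ) :
    FiniteDimensional ℂ V := by
  obtain ⟨U, ⟨e⟩⟩ := h
  exact e.toLinearEquiv.symm.finiteDimensional

theorem occursIn_of_injective (f : IntertwiningMap ρ σ) (hf : Function.Injective f) :
    OccursIn ρ σ :=
  ⟨f.range, ⟨Representation.Equiv.mk (LinearEquiv.ofInjective f.toLinearMap hf) fun g => by
    ext v
    exact IntertwiningMap.isIntertwining _ _ f g v⟩⟩

theorem equivalent_of_ne_zero (hρ : ρ.IsIrreducible) (hσ : σ.IsIrreducible)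
    (f : IntertwiningMap ρ σ) (hf : f ≠ 0) : Equivalent ρ σ :=
  ⟨f.ofBijective ((IsIrreducible.bijective_or_eq_zero f).resolve_right hf)⟩

/-- Schur's lemma. -/
theorem exists_eq_smul_of_ne_zero [FiniteDimensional ℂ V] (hρ : ρ.IsIrreducible)
    (hσ : σ.IsIrreducible) (f h : IntertwiningMap ρ σ) (hf : f ≠ 0) :
    ∃ c : ℂ, ∀ v, h v = c • f v := by
  let e : ρ.Equiv σ := f.ofBijective ((IsIrreducible.bijective_or_eq_zero f).resolve_right hf)
  obtain ⟨c, hc⟩ := (IsIrreducible.algebraMap_intertwiningMap_bijective_of_isAlgClosed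
    (ρ := ρ)).2 (e.symm.toIntertwiningMap.comp h)
  refine ⟨c, fun v => ?_⟩
  have h1 : c • v = e.symm (h v) := congrArg (fun F : IntertwiningMap ρ ρ => F v) hc
  have h2 : e (c • v) = h v := by
    rw [h1]; exact e.toLinearEquiv.apply_symm_apply (h v)
  rw [← h2, map_smul]
  rfl

end Equivalence

/-! ### Irreducibility of the τ-conjugate. -/

section TauConj

variable {G : Type*} [Group G] (τ : InvolutoryAntiAut G)

theorem InvolutoryAntiAut.map_inv (g : G) : τ g⁻¹ = (τ g)⁻¹ := by
  rw [eq_inv_iff_mul_eq_one, ← τ.map_mul, mul_inv_cancel, τ.map_one]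

theorem InvolutoryAntiAut.map_mem {τ : InvolutoryAntiAut G} {K : Subgroup G}
    (hK : τ '' (K : Set G) = K) {k : G} (hk : k ∈ K) : τ k ∈ K := by
  have h : τ k ∈ τ '' (K : Set G) := ⟨k, hk, rfl⟩
  rwa [hK] at h

/-- The common kernel of an invariant subspace of the dual is invariant under `ρ`, and in finite
dimension it determines that subspace. -/
theorem isIrreducible_tauConj {V : Type*} [AddCommGroup V] [Module ℂ V] [FiniteDimensional ℂ V]
    {ρ : Representation ℂ G V} (hρ : ρ.IsIrreducible) : (tauConj τ ρ).IsIrreducible := by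
  obtain ⟨hV, hU⟩ := isIrreducible_iff.1 hρ
  refine isIrreducible_iff.2 ⟨inferInstance, fun Φ hΦ => ?_⟩
  have key := hU Φ.dualCoannihilator fun g v hv => by
    rw [Submodule.mem_dualCoannihilator] at hv ⊢
    intro φ hφ
    have := hv _ (hΦ (τ g) φ hφ)
    rwa [tauConj_apply, τ.involutive] at this
  rw [← Subspace.dualCoannihilator_dualAnnihilator_eq (W := Φ)]
  rcases key with h | h <;> rw [h] <;> simp

end TauConj

/-! ### K-fixed vectors, K-invariant functionals and Frobenius reciprocity. -/

section Invariants

variable {G : Type*} [Group G] (K : Subgroup G) {V : Type*} [AddCommGroup V] [Module ℂ V]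
  (ρ : Representation ℂ G V)

/-- The vectors fixed by the subgroup `K`. -/
def IsFixed (v : V) : Prop := ∀ k ∈ K, ρ k v = v

/-- The functionals invariant under the subgroup `K`. -/
def IsInvariantFunctional (φ : Module.Dual ℂ V) : Prop := ∀ k ∈ K, ∀ v, φ (ρ k v) = φ v

/-- The average of a vector over the subgroup `K`. -/
noncomputable def average : V →ₗ[ℂ] V :=
  (Nat.card K : ℂ)⁻¹ • ∑ᶠ k : K, ρ k

variable {K ρ}

theorem average_apply [Finite G] (v : V) :
    average K ρ v = (Nat.card K : ℂ)⁻¹ • ∑ᶠ k : K, ρ k v := by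
  have := Fintype.ofFinite K
  simp [average, finsum_eq_sum_of_fintype]

theorem isFixed_average [Finite G] (v : V) : IsFixed K ρ (average K ρ v) := by
  have := Fintype.ofFinite K
  intro k hk
  rw [average_apply, map_smul, finsum_eq_sum_of_fintype, map_sum]
  congr 1
  refine Fintype.sum_equiv (Equiv.mulLeft ⟨k, hk⟩) _ _ fun x => ?_
  simp

theorem average_map [Finite G] {k : G} (hk : k ∈ K) (v : V) :
    average K ρ (ρ k v) = average K ρ v := by
  have := Fintype.ofFinite K
  rw [average_apply, average_apply, finsum_eq_sum_of_fintype, finsum_eq_sum_of_fintype]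
  congr 1
  refine Fintype.sum_equiv (Equiv.mulRight ⟨k, hk⟩) _ _ fun x => ?_
  simp

theorem IsInvariantFunctional.apply_average [Finite G] {φ : Module.Dual ℂ V}
    (hφ : IsInvariantFunctional K ρ φ) (v : V) : φ (average K ρ v) = φ v := by
  have := Fintype.ofFinite K
  rw [average_apply, map_smul, finsum_eq_sum_of_fintype, map_sum,
    Finset.sum_congr rfl fun (k : K) _ => hφ k k.2 v]
  simp

theorem IsFixed.average_eq [Finite G] {v : V} (hv : IsFixed K ρ v) : average K ρ v = v := by
  have := Fintype.ofFinite K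
  rw [average_apply, finsum_eq_sum_of_fintype, Finset.sum_congr rfl fun (k : K) _ => hv k k.2]
  simp [← Nat.cast_smul_eq_nsmul ℂ, smul_smul]

theorem isInvariantFunctional_comp_average [Finite G] (φ : Module.Dual ℂ V) :
    IsInvariantFunctional K ρ (φ ∘ₗ average K ρ) := fun k hk v => by
  simp [average_map hk]

/-- The intertwining map to functions on `G ⧸ K` given by a `K`-invariant functional. -/
def orbitMap (φ : Module.Dual ℂ V) (hφ : IsInvariantFunctional K ρ φ) :
    IntertwiningMap ρ (permRep K) where
  toFun v := fun x => Quotient.liftOn x (fun g => φ (ρ g⁻¹ v)) fun a b hab => by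
    have h : a⁻¹ * b ∈ K := QuotientGroup.leftRel_apply.mp hab
    have := hφ _ h (ρ b⁻¹ v)
    rwa [← Module.End.mul_apply, ← map_mul, mul_assoc, mul_inv_cancel, mul_one] at this
  map_add' v w := by
    ext x
    induction x using QuotientGroup.induction_on with
    | H g => change φ (ρ g⁻¹ (v + w)) = φ (ρ g⁻¹ v) + φ (ρ g⁻¹ w); simp
  map_smul' c v := by
    ext x
    induction x using QuotientGroup.induction_on with
    | H g => change φ (ρ g⁻¹ (c • v)) = c • φ (ρ g⁻¹ v); simp
  isIntertwining' h := by
    refine LinearMap.ext fun v => funext fun x => ?_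
    induction x using QuotientGroup.induction_on with
    | H g =>
      change φ (ρ g⁻¹ (ρ h v)) = φ (ρ (h⁻¹ * g)⁻¹ v)
      rw [mul_inv_rev, inv_inv, map_mul]
      rfl

theorem orbitMap_apply (φ : Module.Dual ℂ V) (hφ : IsInvariantFunctional K ρ φ) (v : V) (g : G) :
    orbitMap φ hφ v (g : G ⧸ K) = φ (ρ g⁻¹ v) := rfl

/-- Evaluating `orbitMap` at the base point returns φ, so the map is nonzero, hence injective by
irreducibility. -/
theorem occursIn_of_isInvariantFunctional (hρ : ρ.IsIrreducible) {φ : Module.Dual ℂ V}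
    (hφ : IsInvariantFunctional K ρ φ) (h0 : φ ≠ 0) : OccursIn ρ (permRep K) := by
  refine occursIn_of_injective (orbitMap φ hφ)
    ((IsIrreducible.injective_or_eq_zero _).resolve_right fun h => h0 ?_)
  ext v
  have := congrArg (fun F : IntertwiningMap ρ (permRep K) => F v ((1 : G) : G ⧸ K)) h
  simpa [orbitMap_apply] using this

end Invariants

/-! ### Spherical functions. -/

section Spherical

variable {G : Type*} [Group G] {K : Subgroup G} {V W : Type*} [AddCommGroup V] [Module ℂ V]
  [AddCommGroup W] [Module ℂ W] {ρ : Representation ℂ G V} {σ : Representation ℂ G W}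

/-- `s`, seen as a function on the `K`-orbits on `G ⧸ K`, is the normalized matrix coefficient
`g ↦ φ (ρ g⁻¹ v)` of a `K`-fixed vector `v` and a `K`-invariant functional `φ`. -/
def IsSpherical (ρ : Representation ℂ G V) (s : KOrbits K → ℂ) : Prop :=
  ∃ (φ : Module.Dual ℂ V) (v : V), IsInvariantFunctional K ρ φ ∧ IsFixed K ρ v ∧ φ v = 1 ∧
    ∀ g : G, s (orbitOf K (g : G ⧸ K)) = φ (ρ g⁻¹ v)

theorem IsSpherical.congr {s : KOrbits K → ℂ} (hs : IsSpherical ρ s) (h : Equivalent ρ σ) :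
    IsSpherical σ s := by
  obtain ⟨φ, v, hφ, hv, h1, hs⟩ := hs
  obtain ⟨e⟩ := h
  have he : ∀ g x, e (ρ g x) = σ g (e x) :=
    fun g x => IntertwiningMap.isIntertwining _ _ e.toIntertwiningMap g x
  have he' : ∀ g x, e.symm (σ g x) = ρ g (e.symm x) :=
    fun g x => IntertwiningMap.isIntertwining _ _ e.symm.toIntertwiningMap g x
  have hinv : ∀ x, e.symm (e x) = x := e.toLinearEquiv.symm_apply_apply
  refine ⟨φ ∘ₗ e.symm.toLinearMap, e v, fun k hk w => ?_, fun k hk => ?_, ?_, fun g => ?_⟩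
  · change φ (e.symm _) = φ (e.symm _)
    rw [he', hφ k hk]
  · rw [← he, hv k hk]
  · change φ (e.symm _) = 1
    rw [hinv, h1]
  · change _ = φ (e.symm _)
    rw [he', hinv, hs]

/-- On the dual space, evaluation at `v` becomes the invariant functional and `φ` the fixed vector;
both use τ(K) = K. -/
theorem IsSpherical.tauConj {τ : InvolutoryAntiAut G} (hK : τ '' (K : Set G) = K)
    {s : KOrbits K → ℂ} (hs : IsSpherical ρ s) :
    IsSpherical (tauConj τ ρ) (s ∘ tauOrbit τ K hK) := by
  obtain ⟨φ, v, hφ, hv, h1, hs⟩ := hs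
  refine ⟨Module.Dual.eval ℂ V v, φ, fun k hk ψ => ?_, fun k hk => ?_, h1, fun g => ?_⟩
  · rw [Module.Dual.eval_apply, tauConj_apply, hv _ (InvolutoryAntiAut.map_mem hK hk)]
    rfl
  · ext w
    rw [tauConj_apply, hφ _ (InvolutoryAntiAut.map_mem hK hk)]
  · rw [Function.comp_apply, tauOrbit_orbitOf, hs, Module.Dual.eval_apply, tauConj_apply,
      τ.map_inv]

theorem IsSpherical.occursIn {s : KOrbits K → ℂ} (hρ : ρ.IsIrreducible)
    (hs : IsSpherical ρ s) : OccursIn ρ (permRep K) := by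
  obtain ⟨φ, v, hφ, hv, h1, hs⟩ := hs
  refine occursIn_of_isInvariantFunctional hρ hφ ?_
  rintro rfl
  simp at h1

/-- A function on the `K`-orbits as a function on `G ⧸ K`. -/
def orbitPullback (K : Subgroup G) : (KOrbits K → ℂ) →ₗ[ℂ] (G ⧸ K → ℂ) :=
  LinearMap.funLeft ℂ ℂ (orbitOf K)

theorem orbitPullback_injective : Function.Injective (orbitPullback K) :=
  LinearMap.funLeft_injective_of_surjective _ _ _ Quotient.mk_surjective

theorem orbitOf_smul (k : K) (x : G ⧸ K) : orbitOf K (k • x) = orbitOf K x :=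
  Quotient.sound (MulAction.orbitRel_apply.mpr ⟨k, rfl⟩)

theorem isFixed_orbitPullback (s : KOrbits K → ℂ) :
    IsFixed K (permRep K) (orbitPullback K s) := fun k hk => by
  ext x
  exact congrArg s (orbitOf_smul (⟨k, hk⟩⁻¹ : K) x)

theorem IsFixed.exists_eq_orbitPullback {f : G ⧸ K → ℂ} (hf : IsFixed K (permRep K) f) :
    ∃ s, orbitPullback K s = f := by
  refine ⟨Quotient.lift f fun x y hxy => ?_, rfl⟩
  obtain ⟨k, rfl⟩ := MulAction.orbitRel_apply.mp hxy
  have := congrFun (hf _ (k⁻¹).2) y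
  change f (((k⁻¹ : K) : G)⁻¹ • y) = f y at this
  rw [Subgroup.coe_inv, inv_inv] at this
  exact this

/-- An irreducible subrepresentation of `L(G/K)` contains its spherical function. -/
theorem exists_isSpherical_subrepresentation [Finite G] (U : Subrepresentation (permRep K))
    (hU : U.toRepresentation.IsIrreducible) :
    ∃ s, orbitPullback K s ∈ U.toSubmodule ∧ IsSpherical U.toRepresentation s := by
  let φ : Module.Dual ℂ U.toSubmodule :=
    LinearMap.proj ((1 : G) : G ⧸ K) ∘ₗ U.toSubmodule.subtype
  have hval : ∀ (g : G) (u : U.toSubmodule),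
      φ (U.toRepresentation g⁻¹ u) = (u : G ⧸ K → ℂ) (g : G ⧸ K) := fun g u => by
    change (u : G ⧸ K → ℂ) ((g⁻¹⁻¹ * 1 : G) : G ⧸ K) = _
    simp
  have hφ : IsInvariantFunctional K U.toRepresentation φ := fun k hk u => by
    have h1 := hval k⁻¹ u
    have h2 := hval 1 u
    rw [inv_inv] at h1
    rw [inv_one, map_one, Module.End.one_apply] at h2
    rw [h1, h2]
    exact congrArg (u : G ⧸ K → ℂ)
      (QuotientGroup.eq.mpr (by rwa [inv_inv, mul_one]) : ((k⁻¹ : G) : G ⧸ K) = ((1 : G) : G ⧸ K))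
  -- Translates of evaluation at the base point are all the point evaluations, so they cannot all
  -- vanish on a nonzero space.
  have h0 : ∃ u, φ u ≠ 0 := by
    by_contra! h
    obtain ⟨u, hu⟩ := @exists_ne _ (isIrreducible_iff.1 hU).1 0
    refine hu (Subtype.ext (funext fun x => ?_))
    induction x using QuotientGroup.induction_on with
    | H g => rw [← hval, h]; rfl
  obtain ⟨u, hu⟩ := h0
  -- Averaging makes `u` K-fixed without changing its value under the invariant `φ`; the scalar then
  -- gives φ(v) = 1.
  let v : U.toSubmodule := (φ u)⁻¹ • average K U.toRepresentation u
  have hv : IsFixed K U.toRepresentation v := fun k hk => by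
    rw [map_smul, isFixed_average u k hk]
  obtain ⟨s, hs⟩ := IsFixed.exists_eq_orbitPullback (K := K) (f := v) fun k hk =>
    congrArg Subtype.val (hv k hk)
  refine ⟨s, hs ▸ v.2, φ, v, hφ, hv, ?_, fun g => ?_⟩
  · rw [map_smul, hφ.apply_average, smul_eq_mul, inv_mul_cancel₀ hu]
  · rw [hval, ← hs]
    rfl

theorem OccursIn.exists_isSpherical [Finite G] (hρ : ρ.IsIrreducible)
    (h : OccursIn ρ (permRep K)) : ∃ s : KOrbits K → ℂ, IsSpherical ρ s := by
  obtain ⟨U, hU⟩ := h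
  obtain ⟨s, -, hs⟩ := exists_isSpherical_subrepresentation U (hU.isIrreducible hρ)
  exact ⟨s, hs.congr hU.symm⟩

end Spherical

/-! ### Equivariant projections onto summands. -/

section Projection

variable {G : Type*} [Group G] {V : Type*} [AddCommGroup V] [Module ℂ V]
  {σ : Representation ℂ G V} {n : ℕ} {U : Fin n → Subrepresentation σ}

/-- The projections of an internal direct sum of subrepresentations. -/
theorem exists_projections (hint : DirectSum.IsInternal fun i => (U i).toSubmodule) :
    ∃ p : ∀ i, IntertwiningMap σ (U i).toRepresentation,
      ∀ v, ∑ i, (p i v : V) = v := by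
  let e : (DirectSum (Fin n) fun i => (U i).toSubmodule) ≃ₗ[ℂ] V :=
    LinearEquiv.ofBijective (DirectSum.coeLinearMap fun i => (U i).toSubmodule) hint
  have he : ∀ i (u : (U i).toSubmodule), e (DirectSum.lof ℂ _ _ i u) = u := fun i u =>
    DirectSum.coeLinearMap_lof (fun i => (U i).toSubmodule) i u
  have he' : ∀ i (u : (U i).toSubmodule), e.symm u = DirectSum.lof ℂ _ _ i u := fun i u => by
    rw [← he, e.symm_apply_apply]
  refine ⟨fun i => ⟨DirectSum.component ℂ _ _ i ∘ₗ e.symm.toLinearMap, fun g => ?_⟩, fun v => ?_⟩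
  · rw [← LinearMap.cancel_right e.surjective]
    refine DirectSum.linearMap_ext _ fun j => LinearMap.ext fun u => ?_
    have h1 : σ g (u : V) = ((U j).toRepresentation g u : (U j).toSubmodule) := rfl
    simp only [LinearMap.comp_apply, LinearEquiv.coe_coe, he, h1, he']
    by_cases hij : j = i
    · subst hij
      simp [DirectSum.component.lof_self]
    · simp [DirectSum.component.of, hij]
  · obtain ⟨x, rfl⟩ := e.surjective v
    change ∑ i, ((e.symm (e x) i : (U i).toSubmodule) : V) = _
    rw [e.symm_apply_apply]
    conv_rhs => rw [← DirectSum.sum_univ_of x, map_sum]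
    exact Finset.sum_congr rfl fun i _ => (he i (x i)).symm

end Projection

/-! ### Multiplicity one. -/

section Multiplicity

variable {G : Type*} [Group G] {V W : Type*} [AddCommGroup V] [Module ℂ V]
  [AddCommGroup W] [Module ℂ W] {ρ : Representation ℂ G W} {σ : Representation ℂ G V}

theorem exists_equivalent_summand {n : ℕ} {U : Fin n → Subrepresentation σ}
    (hint : DirectSum.IsInternal fun i => (U i).toSubmodule)
    (hirr : ∀ i, (U i).toRepresentation.IsIrreducible) (hρ : ρ.IsIrreducible)
    (h : OccursIn ρ σ) : ∃ i, Equivalent ρ (U i).toRepresentation := by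
  obtain ⟨p, hp⟩ := exists_projections hint
  obtain ⟨S, ⟨e⟩⟩ := h
  let f : IntertwiningMap ρ σ :=
    ⟨S.toSubmodule.subtype ∘ₗ e.toLinearEquiv.toLinearMap, fun g => by
      ext w
      exact congrArg Subtype.val (IntertwiningMap.isIntertwining _ _ e.toIntertwiningMap g w)⟩
  by_contra! hne
  obtain ⟨w, hw⟩ := @exists_ne _ (isIrreducible_iff.1 hρ).1 0
  have hf : f w = 0 := by
    rw [← hp (f w)]
    refine Finset.sum_eq_zero fun i _ => ?_
    have : (p i).comp f = 0 := by
      by_contra h0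
      exact hne i (equivalent_of_ne_zero hρ (hirr i) _ h0)
    rw [← IntertwiningMap.comp_apply, this]
    rfl
  exact hw (e.toLinearEquiv.map_eq_zero_iff.1 (Subtype.ext hf))

/-- An irreducible representation has multiplicity at most one in a multiplicity-free one. -/
theorem MultiplicityFree.exists_eq_smul [FiniteDimensional ℂ W] (hσ : MultiplicityFree σ)
    (hρ : ρ.IsIrreducible) (f h : IntertwiningMap ρ σ) (hf : f ≠ 0) :
    ∃ c : ℂ, ∀ w, h w = c • f w := by
  obtain ⟨n, U, hint, hirr, hineq⟩ := hσ
  obtain ⟨p, hp⟩ := exists_projections hint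
  obtain ⟨j, hj⟩ : ∃ j, (p j).comp f ≠ 0 := by
    by_contra! h0
    refine hf (IntertwiningMap.ext (LinearMap.ext fun w => ?_))
    change f w = 0
    rw [← hp (f w)]
    refine Finset.sum_eq_zero fun i _ => ?_
    rw [← IntertwiningMap.comp_apply, h0]
    rfl
  -- A nonzero component of `q` in another summand would make that summand equivalent to the `j`-th.
  have hzero : ∀ q : IntertwiningMap ρ σ, ∀ w, q w = (p j (q w) : V) := fun q w => by
    conv_lhs => rw [← hp (q w)]
    refine Finset.sum_eq_single _ (fun i _ hij => ?_) (by simp)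
    have : (p i).comp q = 0 := by
      by_contra h0
      exact hineq i j hij ((equivalent_of_ne_zero hρ (hirr i) _ h0).symm.trans
        (equivalent_of_ne_zero hρ (hirr j) _ hj))
    rw [← IntertwiningMap.comp_apply, this]
    rfl
  obtain ⟨c, hc⟩ := exists_eq_smul_of_ne_zero hρ (hirr j) _ ((p j).comp h) hj
  refine ⟨c, fun w => ?_⟩
  rw [hzero h w, hzero f w]
  exact congrArg Subtype.val (hc w)

end Multiplicity

/-! ### Uniqueness and basis property of spherical functions for a Gelfand pair. -/

section Gelfand

variable {G : Type*} [Group G] {K : Subgroup G}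
  {V : Type*} [AddCommGroup V] [Module ℂ V] {ρ : Representation ℂ G V}

theorem IsGelfandPair.exists_functional_eq_smul (hGK : IsGelfandPair K)
    [FiniteDimensional ℂ V] (hρ : ρ.IsIrreducible)
    {φ ψ : Module.Dual ℂ V} (hφ : IsInvariantFunctional K ρ φ)
    (hψ : IsInvariantFunctional K ρ ψ) (h0 : φ ≠ 0) : ∃ c : ℂ, ∀ v, ψ v = c * φ v := by
  have heval : ∀ (χ : Module.Dual ℂ V) (hχ : IsInvariantFunctional K ρ χ) (v : V),
      orbitMap χ hχ v ((1 : G) : G ⧸ K) = χ v := fun χ hχ v => by simp [orbitMap_apply]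
  obtain ⟨c, hc⟩ := MultiplicityFree.exists_eq_smul hGK hρ (orbitMap φ hφ) (orbitMap ψ hψ)
    fun h => h0 (LinearMap.ext fun v => by
      rw [← heval φ hφ, h]
      rfl)
  exact ⟨c, fun v => by rw [← heval ψ hψ, ← heval φ hφ, hc]; rfl⟩

/-- The difference is K-fixed and killed by `φ`. Any functional agrees on fixed vectors with its
K-average, which is a multiple of `φ`; so every functional kills the difference. -/
theorem IsGelfandPair.isFixed_eq_smul [Finite G] (hGK : IsGelfandPair K)
    [FiniteDimensional ℂ V] (hρ : ρ.IsIrreducible)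
    {φ : Module.Dual ℂ V} {v w : V} (hφ : IsInvariantFunctional K ρ φ) (hv : IsFixed K ρ v)
    (h1 : φ v = 1) (hw : IsFixed K ρ w) : w = φ w • v := by
  rw [← sub_eq_zero, ← Module.forall_dual_apply_eq_zero_iff ℂ]
  intro ψ
  have hu : IsFixed K ρ (w - φ w • v) := fun k hk => by
    rw [map_sub, map_smul, hv k hk, hw k hk]
  obtain ⟨c, hc⟩ := hGK.exists_functional_eq_smul hρ hφ
    (isInvariantFunctional_comp_average (K := K) (ρ := ρ) ψ) (by rintro rfl; simp at h1)
  have := hc (w - φ w • v)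
  rw [LinearMap.comp_apply, hu.average_eq] at this
  rw [this, map_sub, map_smul, h1]
  simp

theorem IsGelfandPair.isSpherical_unique [Finite G] (hGK : IsGelfandPair K)
    [FiniteDimensional ℂ V] (hρ : ρ.IsIrreducible)
    {s t : KOrbits K → ℂ} (hs : IsSpherical ρ s) (ht : IsSpherical ρ t) : s = t := by
  obtain ⟨φ, v, hφ, hv, h1, hs⟩ := hs
  obtain ⟨ψ, w, hψ, hw, h2, ht⟩ := ht
  obtain ⟨c, hc⟩ := hGK.exists_functional_eq_smul hρ hφ hψ (by rintro rfl; simp at h1)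
  have hwv := hGK.isFixed_eq_smul hρ hφ hv h1 hw
  have h3 : c * φ w = 1 := by rw [← hc, h2]
  ext Ω
  induction Ω using Quotient.inductionOn with
  | h x =>
    induction x using QuotientGroup.induction_on with
    | H g =>
      have hs' := hs g
      have ht' := ht g
      rw [hwv, map_smul, hc, map_smul, smul_eq_mul, ← mul_assoc, h3, one_mul] at ht'
      exact hs'.trans ht'.symm

/-- Each summand of L(G/K) contributes one spherical function. Independence comes from the direct
sum; they span because each projection of a K-invariant function is K-fixed, and the fixed vectors
of a summand form a line. -/
theorem IsGelfandPair.exists_basis_isSpherical [Finite G] (hGK : IsGelfandPair K)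
    {I : Type*} {W : I → Type*}
    [∀ i, AddCommGroup (W i)] [∀ i, Module ℂ (W i)] {ρ : ∀ i, Representation ℂ G (W i)}
    (hρ : IsCompleteSystem (permRep K) ρ) :
    ∃ (_ : Finite I) (b : Module.Basis I ℂ (KOrbits K → ℂ)), ∀ i, IsSpherical (ρ i) (b i) := by
  obtain ⟨n, U, hint, hirr, hineq⟩ := id hGK
  obtain ⟨p, hp⟩ := exists_projections hint
  choose t htU ht using fun i => exists_isSpherical_subrepresentation (U i) (hirr i)
  choose e he using fun i =>
    exists_equivalent_summand hint hirr (hρ.irreducible i) (hρ.occurs i)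
  have heb : Function.Bijective e := by
    refine ⟨fun i j hij => ?_, fun j => ?_⟩
    · by_contra hne
      exact hρ.inequivalent i j hne ((he i).trans (hij ▸ (he j).symm))
    · obtain ⟨i, hi⟩ := hρ.complete (U j) (hirr j)
      refine ⟨i, ?_⟩
      by_contra hne
      exact hineq _ _ (Ne.symm hne) (hi.trans (he i))
  have hne : ∀ i, orbitPullback K (t i) ≠ 0 := fun i h => by
    obtain ⟨φ, v, -, -, h1, hs⟩ := ht i
    have h2 : t i = 0 := orbitPullback_injective (h.trans (map_zero _).symm)
    have := hs 1
    rw [h2, inv_one, map_one, Module.End.one_apply, h1] at this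
    exact zero_ne_one this
  have hli : LinearIndependent ℂ t := by
    refine LinearIndependent.of_comp (orbitPullback K) ?_
    exact hint.submodule_iSupIndep.linearIndependent _ htU hne
  have hsp : ⊤ ≤ Submodule.span ℂ (Set.range t) := fun s _ => by
    have hsum : ∀ i, ∃ c : ℂ, (p i (orbitPullback K s) : G ⧸ K → ℂ) =
        c • orbitPullback K (t i) := fun i => by
      obtain ⟨φ, v, hφ, hv, h1, -⟩ := ht i
      have hfix : IsFixed K (U i).toRepresentation (p i (orbitPullback K s)) := fun k hk => by
        rw [← IntertwiningMap.isIntertwining, isFixed_orbitPullback s k hk]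
      have hfix' : IsFixed K (U i).toRepresentation ⟨_, htU i⟩ := fun k hk =>
        Subtype.ext (isFixed_orbitPullback (t i) k hk)
      have h2 := hGK.isFixed_eq_smul (hirr i) hφ hv h1 hfix
      have h3 := hGK.isFixed_eq_smul (hirr i) hφ hv h1 hfix'
      -- The spherical function is itself a nonzero fixed vector of its summand, so it can replace
      -- `v` as generator of the fixed line.
      have h4 : φ ⟨_, htU i⟩ ≠ 0 := fun h => hne i (by
        rw [h, zero_smul] at h3
        exact congrArg Subtype.val h3)
      refine ⟨φ (p i (orbitPullback K s)) * (φ ⟨_, htU i⟩)⁻¹, ?_⟩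
      have h5 : v = (φ ⟨_, htU i⟩)⁻¹ • (⟨_, htU i⟩ : (U i).toSubmodule) := by
        conv_rhs => rw [h3]
        rw [smul_smul, map_smul, h1, smul_eq_mul, mul_one, inv_mul_cancel₀ h4, one_smul]
      rw [h5, smul_smul] at h2
      exact congrArg Subtype.val h2
    choose c hc using hsum
    have : s = ∑ i, c i • t i := orbitPullback_injective (by
      rw [map_sum, ← hp (orbitPullback K s)]
      exact Finset.sum_congr rfl fun i _ => by rw [hc, map_smul])
    rw [this]
    exact Submodule.sum_mem _ fun i _ => Submodule.smul_mem _ _ (Submodule.subset_span ⟨i, rfl⟩)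
  refine ⟨Finite.of_injective e heb.1,
    (Module.Basis.mk hli hsp).reindex (Equiv.ofBijective e heb).symm, fun i => ?_⟩
  rw [Module.Basis.reindex_apply, Module.Basis.mk_apply]
  exact (ht (e i)).congr (he i).symm

end Gelfand

/-! ### Trace of a permutation of a basis. -/

section Count

/-- The trace of a linear map permuting a basis is the number of fixed basis vectors. -/
theorem trace_eq_card_fixed {ι M : Type*} [Finite ι] [AddCommGroup M] [Module ℂ M]
    (b : Module.Basis ι ℂ M) (f : M →ₗ[ℂ] M) (π : ι → ι) (h : ∀ i, f (b i) = b (π i)) :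
    LinearMap.trace ℂ M f = Nat.card {i // π i = i} := by
  classical
  have := Fintype.ofFinite ι
  rw [LinearMap.trace_eq_matrix_trace ℂ b, Matrix.trace, Nat.card_eq_fintype_card,
    Fintype.card_subtype]
  simp [LinearMap.toMatrix_apply, h, Finsupp.single_apply]

end Count

/-! ### The two assertions. -/

section Main

theorem tauOrbit_involutive {G : Type*} [Group G] {K : Subgroup G} {τ : InvolutoryAntiAut G}
    (hK : τ '' (K : Set G) = K) :
    Function.Involutive (tauOrbit τ K hK) := fun Ω => by
  induction Ω using Quotient.inductionOn with
  | h x =>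
    induction x using QuotientGroup.induction_on with
    | H g =>
      change tauOrbit τ K hK (tauOrbit τ K hK (orbitOf K (g : G ⧸ K))) = orbitOf K (g : G ⧸ K)
      rw [tauOrbit_orbitOf, tauOrbit_orbitOf, τ.involutive]

variable {G : Type*} [Group G] [Finite G] {K : Subgroup G} {V : Type*} [AddCommGroup V]
  [Module ℂ V] {ρ : Representation ℂ G V} {τ : InvolutoryAntiAut G}

theorem isIrreducible_and_occursIn_tauConj (hK : τ '' (K : Set G) = K) (hρ : ρ.IsIrreducible)
    (h : OccursIn ρ (permRep K)) :
    (tauConj τ ρ).IsIrreducible ∧ OccursIn (tauConj τ ρ) (permRep K) := by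
  have := h.finiteDimensional
  obtain ⟨s, hs⟩ := h.exists_isSpherical hρ
  exact ⟨isIrreducible_tauConj τ hρ, (hs.tauConj hK).occursIn (isIrreducible_tauConj τ hρ)⟩

theorem IsGelfandPair.card_equivalent_tauConj (hGK : IsGelfandPair K)
    (hK : τ '' (K : Set G) = K) {I : Type*} {W : I → Type*}
    [∀ i, AddCommGroup (W i)] [∀ i, Module ℂ (W i)] {ρ : ∀ i, Representation ℂ G (W i)}
    (hρ : IsCompleteSystem (permRep K) ρ) :
    Nat.card {i : I // Equivalent (tauConj τ (ρ i)) (ρ i)} =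
      Nat.card {Ω : KOrbits K // tauOrbit τ K hK Ω = Ω} := by
  obtain ⟨hI, b, hb⟩ := hGK.exists_basis_isSpherical hρ
  have hex : ∀ i, ∃ j, Equivalent (tauConj τ (ρ i)) (ρ j) := fun i => by
    obtain ⟨hirr, U, hU⟩ :=
      isIrreducible_and_occursIn_tauConj hK (hρ.irreducible i) (hρ.occurs i)
    obtain ⟨j, hj⟩ := hρ.complete U (hU.isIrreducible hirr)
    exact ⟨j, hU.trans hj⟩
  choose π hπ using hex
  have hfix : ∀ i, Equivalent (tauConj τ (ρ i)) (ρ i) ↔ π i = i := fun i => by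
    refine ⟨fun h => ?_, fun h => ?_⟩
    · by_contra hne
      exact hρ.inequivalent _ _ hne ((hπ i).symm.trans h)
    · have := hπ i
      rwa [h] at this
  let T := LinearMap.funLeft ℂ ℂ (tauOrbit τ K hK)
  -- `T (b i)` is spherical for `ρ^τ`, hence for the equivalent `ρ (π i)`, so uniqueness identifies
  -- it with `b (π i)`.
  have h1 : LinearMap.trace ℂ _ T = Nat.card {i // π i = i} :=
    trace_eq_card_fixed b T π fun i => by
      have := (hρ.occurs (π i)).finiteDimensional
      exact hGK.isSpherical_unique (hρ.irreducible (π i)) (((hb i).tauConj hK).congr (hπ i))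
        (hb (π i))
  -- As `tauOrbit` is an involution, composing the delta function at Ω with it gives the one at
  -- `tauOrbit` Ω.
  have h2 : LinearMap.trace ℂ _ T = Nat.card {Ω : KOrbits K // tauOrbit τ K hK Ω = Ω} := by
    classical
    refine trace_eq_card_fixed (Pi.basisFun ℂ (KOrbits K)) T (tauOrbit τ K hK) fun Ω => ?_
    ext Ω'
    simp only [T, LinearMap.funLeft_apply, Pi.basisFun_apply, Pi.single_apply,
      (tauOrbit_involutive hK).eq_iff]
  rw [Nat.card_congr (Equiv.subtypeEquivRight hfix)]
  exact_mod_cast h1.symm.trans h2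

theorem IsGelfandPair.frobeniusSchurNumber_eq_one (hGK : IsGelfandPair K)
    (hK : τ '' (K : Set G) = K) (hρ : ρ.IsIrreducible) (h : OccursIn ρ (permRep K))
    (hτ : Equivalent (tauConj τ ρ) ρ) : frobeniusSchurNumber τ ρ = 1 := by
  have := h.finiteDimensional
  have hρτ := isIrreducible_tauConj τ hρ
  obtain ⟨s, φ, v, hφ, hv, h1, -⟩ := h.exists_isSpherical hρ
  obtain ⟨e⟩ := hτ
  let A : Module.Dual ℂ V →ₗ[ℂ] V := e.toLinearMap
  have hA : ∀ g, A ∘ₗ tauConj τ ρ g = ρ g ∘ₗ A := e.isIntertwining'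
  have hAinj : Function.Injective A := e.toLinearEquiv.injective
  have hφ0 : φ ≠ 0 := by rintro rfl; simp at h1
  have hA0 : (⟨A, hA⟩ : IntertwiningMap (tauConj τ ρ) ρ) ≠ 0 := fun h =>
    hφ0 (hAinj (by rw [map_zero]; exact congrArg (fun F : IntertwiningMap _ _ => F φ) h))
  have hschur : ∀ B : Module.Dual ℂ V →ₗ[ℂ] V, (∀ g, B ∘ₗ tauConj τ ρ g = ρ g ∘ₗ B) →
      ∃ c : ℂ, B = c • A := fun B hB => by
    obtain ⟨c, hc⟩ := exists_eq_smul_of_ne_zero hρτ hρ ⟨A, hA⟩ ⟨B, hB⟩ hA0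
    exact ⟨c, LinearMap.ext hc⟩
  -- The intertwiner maps the invariant functional to a nonzero multiple of the fixed vector.
  have hφA : φ (A φ) ≠ 0 := fun h0 => by
    have hfix : IsFixed K ρ (A φ) := fun k hk => by
      rw [← LinearMap.comp_apply, ← hA, LinearMap.comp_apply]
      congr 1
      ext w
      rw [tauConj_apply, hφ _ (InvolutoryAntiAut.map_mem hK hk)]
    have := hGK.isFixed_eq_smul hρ hφ hv h1 hfix
    rw [h0, zero_smul, ← map_zero A] at this
    exact hφ0 (hAinj this)
  -- The transpose of the intertwiner.
  let B : Module.Dual ℂ V →ₗ[ℂ] V := (Module.evalEquiv ℂ V).symm.toLinearMap ∘ₗ A.dualMap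
  have hB : ∀ u w : Module.Dual ℂ V, u (B w) = w (A u) := fun u w => by
    change u ((Module.evalEquiv ℂ V).symm (A.dualMap w)) = _
    rw [Module.apply_evalEquiv_symm_apply]
    rfl
  have hAapp : ∀ g u, A (tauConj τ ρ g u) = ρ g (A u) := fun g u => LinearMap.congr_fun (hA g) u
  have hBint : ∀ g, B ∘ₗ tauConj τ ρ g = ρ g ∘ₗ B := fun g => by
    refine LinearMap.ext fun w => ?_
    rw [← sub_eq_zero, ← Module.forall_dual_apply_eq_zero_iff ℂ]
    intro u
    have h2 : u (ρ g (B w)) = tauConj τ ρ (τ g) u (B w) := by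
      rw [tauConj_apply, τ.involutive]
    rw [map_sub]
    change u (B (tauConj τ ρ g w)) - u (ρ g (B w)) = 0
    rw [hB, h2, hB, hAapp, tauConj_apply, sub_self]
  obtain ⟨c, hc⟩ := hschur B hBint
  have hc1 : c = 1 := by
    have := hB φ φ
    rw [hc, LinearMap.smul_apply, map_smul, smul_eq_mul] at this
    exact mul_right_cancel₀ hφA (this.trans (one_mul _).symm)
  rw [hc1, one_smul] at hc
  have hsymm : ∀ u w : Module.Dual ℂ V, w (A u) = u (A w) := fun u w => by rw [← hB, hc]
  have hsym1 : homSym τ ρ = Submodule.span ℂ {A} := by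
    refine le_antisymm (fun D hD => ?_) ?_
    · obtain ⟨d, rfl⟩ := hschur D hD.1
      exact Submodule.mem_span_singleton.2 ⟨d, rfl⟩
    · rw [Submodule.span_singleton_le_iff_mem]
      exact ⟨hA, hsymm⟩
  have hskew : homSkew τ ρ = ⊥ := by
    rw [eq_bot_iff]
    intro D hD
    obtain ⟨d, rfl⟩ := hschur D hD.1
    -- Skewness on the pair (φ, φ) makes d·φ(Aφ) its own negative, hence zero.
    have h2 := hD.2 φ φ
    rw [self_eq_neg, LinearMap.smul_apply, map_smul, smul_eq_mul] at h2
    rw [(mul_eq_zero.1 h2).resolve_right hφA, zero_smul]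
    exact Submodule.zero_mem _
  have hAne : A ≠ 0 := fun h => hφA (by rw [h]; simp)
  rw [frobeniusSchurNumber, hsym1, hskew, finrank_span_singleton hAne, finrank_bot]
  simp

end Main

end TwistedFS

theorem theorem9p2 {G : Type*} [Group G] [Finite G] (K : Subgroup G)
    (hGK : TwistedFS.IsGelfandPair K) (τ : TwistedFS.InvolutoryAntiAut G)
    (hK : τ '' (K : Set G) = K) :
    -- if `ρ` is an irreducible representation occurring in `L(G/K)`, then so is `ρ^τ`
    (∀ (V : Type*) [AddCommGroup V] [Module ℂ V] (ρ : Representation ℂ G V),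
      ρ.IsIrreducible → TwistedFS.OccursIn ρ (TwistedFS.permRep K) →
        (TwistedFS.tauConj τ ρ).IsIrreducible ∧
          TwistedFS.OccursIn (TwistedFS.tauConj τ ρ) (TwistedFS.permRep K)) ∧
    -- the number of such `ρ`, up to equivalence, with `ρ^τ ∼ ρ` is the number of `τ`-invariant
    -- `K`-orbits on `G/K`
    (∀ (I : Type*) (W : I → Type*) [∀ i, AddCommGroup (W i)] [∀ i, Module ℂ (W i)]
      (ρ : ∀ i, Representation ℂ G (W i)),
      TwistedFS.IsCompleteSystem (TwistedFS.permRep K) ρ →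
        Nat.card {i : I // TwistedFS.Equivalent (TwistedFS.tauConj τ (ρ i)) (ρ i)} =
          Nat.card {Ω : TwistedFS.KOrbits K // TwistedFS.tauOrbit τ K hK Ω = Ω}) ∧
    -- `C_τ(ρ) = 1` for every such `ρ` with `ρ^τ ∼ ρ`
    (∀ (V : Type*) [AddCommGroup V] [Module ℂ V] (ρ : Representation ℂ G V),
      ρ.IsIrreducible → TwistedFS.OccursIn ρ (TwistedFS.permRep K) →
        TwistedFS.Equivalent (TwistedFS.tauConj τ ρ) ρ →
          TwistedFS.frobeniusSchurNumber τ ρ = 1) := by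
  refine ⟨fun V _ _ ρ hρ h => TwistedFS.isIrreducible_and_occursIn_tauConj hK hρ h,
    fun I W _ _ ρ hρ => hGK.card_equivalent_tauConj hK hρ,
    fun V _ _ ρ hρ h hτ => hGK.frobeniusSchurNumber_eq_one hK hρ h hτ⟩
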